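/- Let $G$ be a finitely generated group. The following are equivalent. (a) There exists a subgroup $K\le G$ with $e(G,K)>1$. (b) $G$ admits a non-elliptic action on a non-empty discrete median algebra. Here the terms have the following meaning. *Ends.* For a subgroup $K\le G$ let $\mathcal P(K\backslash G)$ be the $\mathbb F_2$-vector space of all subsets $A\subseteq G$ with $KA=A$, with symmetric difference as addition and with $G$ acting by right multiplication, and let $\mathcal F(K\backslash G)$ be the submodule of the $K$-finite sets, that is, the sets $KF$ with $F\subseteq G$ finite. Then $$e(G,K):=\dim_{\mathbb F_2}\bigl(\mathcal P(K\backslash G)/\mathcal F(K\backslash G)\bigr)^G .$$ *Median algebras.* A median algebra is a set $M$ with a map $m:M\times M\times M\to M$ such that $m(x,y,z)=m(x,z,y)=m(y,z,x)$, $m(x,x,y)=x$ and $m(m(x,y,z),u,v)=m(x,m(y,u,v),m(z,u,v))$ for all $x,y,z,u,v\in M$. The interval between $x$ and $y$ is $[x,y]=\{z\in M: z=m(x,y,z)\}$; a subset $C\subseteq M$ is convex if $[x,y]\subseteq C$ for all $x,y\in C$; a half space is a subset $H\subseteq M$ such that $H$ and $M\setminus H$ are both convex. For $x,y\in M$ let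 $\Delta(x,y)$ be the set of half spaces $H$ with $x\in H$ and $y\notin H$. The median algebra $M$ is discrete if $\Delta(x,y)$ is finite for all $x,y\in M$; then put $d(x,y)=|\Delta(x,y)|$. *Actions.* An action of $G$ on $M$ is an action by automorphisms, that is, $g\,m(x,y,z)=m(gx,gy,gz)$ for all $g\in G$ and $x,y,z\in M$. An action on a discrete median algebra $M$ is elliptic if for some $x\in M$ the orbit $Gx$ is bounded, that is, there is an $N\in\mathbb N$ with $d(y,z)\le N$ for all $y,z\in Gx$; otherwise it is non-elliptic. -/

import Mathlib

open scoped Pointwise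

universe u v

/-! ### Median algebras -/

/-- A median algebra: a type with a ternary operation `med` satisfying the median axioms. -/
class MedianAlgebra (M : Type v) where
  /-- The median of three points. -/
  med : M → M → M → M
  med_swap : ∀ x y z : M, med x y z = med x z y
  med_rotate : ∀ x y z : M, med x y z = med y z x
  med_self : ∀ x y : M, med x x y = x
  med_med : ∀ x y z u w : M, med (med x y z) u w = med x (med y u w) (med z u w)

namespace MedianAlgebra

section

variable {M : Type v} [MedianAlgebra M]

/-- The interval `[x, y]`. -/
def interval (x y : M) : Set M := {z | z = med x y z}

/-- Convex subsets of a median algebra. -/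
def IsConvex (C : Set M) : Prop := ∀ x ∈ C, ∀ y ∈ C, interval x y ⊆ C

/-- Half spaces: convex subsets with convex complement. -/
def IsHalfSpace (H : Set M) : Prop := IsConvex H ∧ IsConvex Hᶜ

/-- The separator `Δ(x, y)`: the set of all half spaces containing `x` but not `y`. -/
def separator (x y : M) : Set (Set M) := {H | IsHalfSpace H ∧ x ∈ H ∧ y ∉ H}

/-- The distance `d(x, y)`, i.e. the number of half spaces containing `x` but not `y`. It is
used only for discrete median algebras, where this number is finite. -/
noncomputable def dist (x y : M) : ℕ := (separator x y).ncard

/-- A subset is bounded if its diameter with respect to `dist` is finite. -/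
def IsBounded (X : Set M) : Prop := ∃ N : ℕ, ∀ x ∈ X, ∀ y ∈ X, dist x y ≤ N

end

/-- A median algebra is discrete if all separators of pairs of points are finite. -/
def IsDiscrete (M : Type v) [MedianAlgebra M] : Prop := ∀ x y : M, (separator x y).Finite

/-- The group `G` acts on `M` by automorphisms of the median algebra. -/
def IsMedianAction (G : Type u) [Group G] (M : Type v) [MedianAlgebra M] [MulAction G M] : Prop :=
  ∀ (g : G) (x y z : M), g • med x y z = med (g • x) (g • y) (g • z)

/-- An action is elliptic if some orbit is bounded. -/
def IsElliptic (G : Type u) [Group G] (M : Type v) [MedianAlgebra M] [MulAction G M] : Prop :=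
  ∃ x : M, IsBounded (MulAction.orbit G x)

end MedianAlgebra

/-! ### Ends of pairs of groups -/

namespace EndsOfPairs

variable {G : Type u} [Group G] (K : Subgroup G)

/-- The `𝔽₂`-module `𝒫(K\G)` of subsets `A ⊆ G` with `K A = A`, with symmetric difference as
addition. A subset `A` is represented by its indicator function `G → 𝔽₂`. -/
def invariantSets : Submodule (ZMod 2) (G → ZMod 2) where
  carrier := {f | ∀ k ∈ K, ∀ g : G, f (k * g) = f g}
  zero_mem' := fun _ _ _ => rfl
  add_mem' := fun {a b} ha hb k hk g => by
    simp only [Pi.add_apply, ha k hk g, hb k hk g]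
  smul_mem' := fun c a ha k hk g => by
    simp only [Pi.smul_apply, ha k hk g]

/-- The subset of `G` represented by an element of `invariantSets K`. -/
def toSet (f : invariantSets K) : Set G := {g | (f : G → ZMod 2) g ≠ 0}

/-- `A` is `K`-finite if `A = K F` for a finite subset `F` of `G`. -/
def IsKFinite (A : Set G) : Prop := ∃ F : Set G, F.Finite ∧ A = (K : Set G) * F

theorem isKFinite_toSet_of_subset (f : invariantSets K) {F : Set G} (hF : F.Finite)
    (h : toSet K f ⊆ (K : Set G) * F) : IsKFinite K (toSet K f) := by
  refine ⟨F ∩ toSet K f, hF.inter_of_left _, Set.Subset.antisymm ?_ ?_⟩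
  · intro g hg
    obtain ⟨k, hk, x, hx, rfl⟩ := Set.mem_mul.1 (h hg)
    refine Set.mul_mem_mul hk ⟨hx, ?_⟩
    have := f.2 k hk x
    simp only [toSet, Set.mem_ofPred_eq] at hg ⊢
    rwa [← this]
  · rintro _ ⟨k, hk, x, ⟨-, hx⟩, rfl⟩
    have := f.2 k hk x
    simp only [toSet, Set.mem_ofPred_eq] at hx ⊢
    rwa [this]

/-- The submodule `ℱ(K\G)` of `K`-finite sets. -/
def finiteSets : Submodule (ZMod 2) (invariantSets K) where
  carrier := {f | IsKFinite K (toSet K f)}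
  zero_mem' := isKFinite_toSet_of_subset K 0 Set.finite_empty (fun _ hg => absurd rfl hg)
  add_mem' := fun {a b} ha hb => by
    obtain ⟨A, hA, hA'⟩ := ha
    obtain ⟨B, hB, hB'⟩ := hb
    refine isKFinite_toSet_of_subset K (a + b) (hA.union hB) ?_
    rw [Set.mul_union, ← hA', ← hB']
    intro g hg
    by_contra hn
    simp only [toSet, Set.mem_union, Set.mem_ofPred_eq, not_or, not_not] at hn
    exact hg (show (a : G → ZMod 2) g + (b : G → ZMod 2) g = 0 by rw [hn.1, hn.2, add_zero])
  smul_mem' := fun c a ha => by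
    obtain ⟨A, hA, hA'⟩ := ha
    refine isKFinite_toSet_of_subset K (c • a) hA ?_
    rw [← hA']
    intro g hg hn
    exact hg (show c * (a : G → ZMod 2) g = 0 by rw [hn, mul_zero])

/-- The action of `G` on `𝒫(K\G)` by right multiplication: `g` sends the set `A` to `A g⁻¹`. (The
inverse turns the right module structure `A ↦ A g` into a left one.) -/
def rightMul : Representation (ZMod 2) G (invariantSets K) where
  toFun g :=
    { toFun := fun f => ⟨fun h => (f : G → ZMod 2) (h * g), fun k hk h => by
        show (f : G → ZMod 2) (k * h * g) = _
        rw [mul_assoc]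
        exact f.2 k hk (h * g)⟩
      map_add' := fun _ _ => rfl
      map_smul' := fun _ _ => rfl }
  map_one' := by
    ext f h
    exact congrArg (f : G → ZMod 2) (mul_one h)
  map_mul' := fun a b => by
    ext f h
    exact congrArg (f : G → ZMod 2) (mul_assoc h a b).symm

theorem finiteSets_le_comap (g : G) :
    finiteSets K ≤ (finiteSets K).comap (rightMul K g) := by
  rintro f ⟨F, hF, hF'⟩
  refine isKFinite_toSet_of_subset K (rightMul K g f) (hF.image (· * g⁻¹)) ?_
  intro h hh
  have h1 : h * g ∈ toSet K f := hh
  rw [hF'] at h1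
  obtain ⟨k, hk, x, hx, hkx⟩ := Set.mem_mul.1 h1
  refine Set.mem_mul.2 ⟨k, hk, x * g⁻¹, ⟨x, hx, rfl⟩, ?_⟩
  rw [← mul_assoc, hkx, mul_inv_cancel_right]

/-- The number of ends of the pair `(G, K)`: the dimension over `𝔽₂` of the submodule of
`G`-fixed elements of `𝒫(K\G) / ℱ(K\G)`. -/
noncomputable def numEnds : Cardinal.{u} :=
  Module.rank (ZMod 2)
    ((rightMul K).quotient (finiteSets K) (finiteSets_le_comap K)).invariants

end EndsOfPairs

/-!
Both directions rest on a reformulation: `(G, K)` has more than one end if and only if `G ⧸ K` has a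
subset `B` which is *commensurated*, i.e. `g • B` differs from `B` in finitely many points for each
`g : G`, and which is infinite with infinite complement (`EndsOfPairs.one_lt_numEnds_iff`).

*From ends to actions.* Given `B`, the subsets of `G ⧸ K` almost equal to `B` form a median algebra
under majority vote. It is discrete because its intervals are finite and a half space separating
`x` from `y` is determined by its trace on `[x, y]`. If an orbit were bounded, there would be a set
`X` almost equal to `B` with `g • X` differing from `X` in a bounded number of points. By
`Set.finite_or_finite_compl_of_ncard_symmDiff_le`, as `G` is transitive on `G ⧸ K`, such an `X` is
finite or cofinite, a contradiction.

*From actions to ends.* Let `H` be a half space with stabilizer `K`, and let `x` be a point. The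
half spaces in the orbit of `H` that contain `x` form a commensurated subset of this orbit, which is
isomorphic to `G ⧸ K`. So if no pair `(G, K)` has more than one end, either finitely many half spaces
in each orbit contain `x` or finitely many do not. This bounds the number of half spaces of the orbit
that separate `x` from `g • x`, independently of `g`. As `G` is finitely generated, only finitely
many orbits of half spaces contribute to the distances `d(x, g • x)`, and the action is elliptic
(`MedianAlgebra.IsMedianAction.exists_one_lt_numEnds`).
-/

/-! ### Ends of pairs of groups and commensurated sets of cosets -/

namespace EndsOfPairs

variable {G : Type u} [Group G] {K : Subgroup G}

/-- The set of left cosets `g K` for which `g⁻¹` belongs to the set represented by `f`. Inversion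
turns the space `K \ G` with its right `G`-action into `G ⧸ K` with its left action. -/
def cosets (f : invariantSets K) : Set (G ⧸ K) :=
  {q | ∃ g : G, (f : G → ZMod 2) g ≠ 0 ∧ ((g⁻¹ : G) : G ⧸ K) = q}

theorem mk_mem_cosets (f : invariantSets K) (g : G) :
    (g : G ⧸ K) ∈ cosets f ↔ (f : G → ZMod 2) g⁻¹ ≠ 0 := by
  constructor
  · rintro ⟨h, hh, hq⟩
    have hk : h * g ∈ K := by simpa using QuotientGroup.eq.1 hq
    have := f.2 _ hk g⁻¹
    rw [mul_inv_cancel_right] at this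
    rwa [← this]
  · exact fun h => ⟨g⁻¹, h, by rw [inv_inv]⟩

theorem mem_finiteSets_iff (f : invariantSets K) : f ∈ finiteSets K ↔ (cosets f).Finite := by
  constructor
  · rintro ⟨F, hF, hfF⟩
    refine (hF.image fun g : G => ((g⁻¹ : G) : G ⧸ K)).subset ?_
    rintro _ ⟨g, hg, rfl⟩
    have hg' : g ∈ (K : Set G) * F := hfF ▸ hg
    obtain ⟨k, hk, x, hx, rfl⟩ := Set.mem_mul.1 hg'
    refine ⟨x, hx, QuotientGroup.eq.2 ?_⟩
    simpa using hk
  · intro h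
    refine isKFinite_toSet_of_subset K f (h.image fun q : G ⧸ K => q.out⁻¹) fun g hg => ?_
    obtain ⟨k, hk⟩ := QuotientGroup.mk_out_eq_mul K g⁻¹
    refine Set.mem_mul.2 ⟨k, k.2, _, ⟨_, ⟨g, hg, rfl⟩, rfl⟩, ?_⟩
    simp [hk]

/-- The element of `𝒫(K\G)` given by the whole group `G`. -/
def univSet (K : Subgroup G) : invariantSets K := ⟨1, fun _ _ _ => rfl⟩

theorem cosets_univSet_sub (f : invariantSets K) : cosets (univSet K - f) = (cosets f)ᶜ := by
  ext q
  induction q using QuotientGroup.induction_on with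
  | H g =>
    rw [Set.mem_compl_iff, mk_mem_cosets, mk_mem_cosets]
    change (1 : ZMod 2) - (f : G → ZMod 2) g⁻¹ ≠ 0 ↔ _
    generalize (f : G → ZMod 2) g⁻¹ = a
    revert a
    decide

theorem cosets_rightMul_sub (f : invariantSets K) (g : G) :
    cosets (rightMul K g f - f) = symmDiff (g • cosets f) (cosets f) := by
  ext q
  induction q using QuotientGroup.induction_on with
  | H h =>
    rw [Set.mem_symmDiff, Set.mem_smul_set_iff_inv_smul_mem, MulAction.Quotient.smul_coe,
      smul_eq_mul, mk_mem_cosets, mk_mem_cosets, mk_mem_cosets, mul_inv_rev, inv_inv]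
    change (f : G → ZMod 2) (h⁻¹ * g) - (f : G → ZMod 2) h⁻¹ ≠ 0 ↔ _
    generalize (f : G → ZMod 2) (h⁻¹ * g) = a
    generalize (f : G → ZMod 2) h⁻¹ = b
    revert a b
    decide

theorem exists_cosets_eq (B : Set (G ⧸ K)) : ∃ f : invariantSets K, cosets f = B := by
  classical
  refine ⟨⟨fun g => if ((g⁻¹ : G) : G ⧸ K) ∈ B then 1 else 0, fun k hk g => ?_⟩, ?_⟩
  · have : (((k * g)⁻¹ : G) : G ⧸ K) = ((g⁻¹ : G) : G ⧸ K) := QuotientGroup.eq.2 (by simpa using hk)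
    simp only [this]
  · ext q
    induction q using QuotientGroup.induction_on with
    | H h => simp [mk_mem_cosets]

/-- A pair `(G, K)` has more than one end if and only if the `G`-set `G ⧸ K` has a subset which is
infinite, has infinite complement, and is changed by each element of `G` in finitely many points
only. -/
theorem one_lt_numEnds_iff :
    1 < numEnds K ↔ ∃ B : Set (G ⧸ K), B.Infinite ∧ Bᶜ.Infinite ∧
      ∀ g : G, (symmDiff (g • B) B).Finite := by
  set ρ := (rightMul K).quotient (finiteSets K) (finiteSets_le_comap K) with hρ
  have inv_iff (f : invariantSets K) : (finiteSets K).mkQ f ∈ ρ.invariants ↔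
      ∀ g : G, (symmDiff (g • cosets f) (cosets f)).Finite := by
    rw [Representation.mem_invariants]
    refine forall_congr' fun g => ?_
    rw [← cosets_rightMul_sub, ← mem_finiteSets_iff]
    exact Submodule.Quotient.eq _
  have univ_inv : (finiteSets K).mkQ (univSet K) ∈ ρ.invariants := fun g => rfl
  constructor
  · intro h
    by_contra! hB
    refine h.not_ge ?_
    refine rank_le_one_iff.2 ⟨⟨_, univ_inv⟩, ?_⟩
    rintro ⟨x, hx⟩
    obtain ⟨f, rfl⟩ := Submodule.mkQ_surjective _ x
    have h1 := (inv_iff f).1 hx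
    by_cases hf : (cosets f).Finite
    · refine ⟨0, Subtype.ext ?_⟩
      rw [zero_smul]
      exact ((Submodule.Quotient.mk_eq_zero _).2 ((mem_finiteSets_iff f).2 hf)).symm
    · have hc : (cosets f)ᶜ.Finite := by
        by_contra hc
        obtain ⟨g, hg⟩ := hB _ hf hc
        exact hg (h1 g)
      refine ⟨1, Subtype.ext ?_⟩
      rw [one_smul]
      rw [← cosets_univSet_sub, ← mem_finiteSets_iff] at hc
      exact (Submodule.Quotient.eq _).2 hc
  · rintro ⟨B, hB, hBc, hg⟩
    obtain ⟨f, rfl⟩ := exists_cosets_eq B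
    by_contra h
    obtain ⟨v₀, hv⟩ := rank_le_one_iff.1 (not_lt.1 h)
    have hf0 : (finiteSets K).mkQ f ≠ 0 := fun h0 =>
      hB ((mem_finiteSets_iff f).1 ((Submodule.Quotient.mk_eq_zero _).1 h0))
    have hf1 : (finiteSets K).mkQ (univSet K) ≠ (finiteSets K).mkQ f := fun h1 =>
      hBc (by rw [← cosets_univSet_sub, ← mem_finiteSets_iff]; exact (Submodule.Quotient.eq _).1 h1)
    have hu0 : (finiteSets K).mkQ (univSet K) ≠ 0 := fun h0 => by
      have := (mem_finiteSets_iff _).1 ((Submodule.Quotient.mk_eq_zero _).1 h0)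
      refine hB (this.subset ?_)
      rintro _ ⟨g, -, rfl⟩
      exact ⟨g, one_ne_zero, rfl⟩
    -- Over `𝔽₂`, the only nonzero multiple of `v₀` is `v₀` itself.
    have key (x) (hx : x ∈ ρ.invariants) (hx0 : x ≠ 0) : x = v₀ := by
      obtain ⟨r, hr⟩ := hv ⟨x, hx⟩
      have hr0 : r ≠ 0 := by
        rintro rfl
        rw [zero_smul] at hr
        exact hx0 (congrArg Subtype.val hr).symm
      have hr1 : r = 1 := (by decide : ∀ r : ZMod 2, r ≠ 0 → r = 1) r hr0
      rw [hr1, one_smul] at hr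
      exact (congrArg Subtype.val hr).symm
    exact hf1 ((key _ univ_inv hu0).trans (key _ ((inv_iff f).2 hg) hf0).symm)

end EndsOfPairs

/-! ### Commensurated subsets of transitive actions -/

/-- Let `w` be an average of translates of the indicator function of `B`. It takes the values `1`
and `0` unless `B` or `Bᶜ` is finite. By transitivity, some `g : G` moves a point with value `1` to
one with value `0`, and averaging `w` with its translate by `g` increases `∑ s, w s * (1 - w s)` by at
least `1 / 4`. But this sum is bounded by `N`, since `w` has `ℓ¹`-distance at most `N` from the
indicator function. -/
theorem Set.finite_or_finite_compl_of_ncard_symmDiff_le {G : Type u} [Group G] {S : Type v}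
    [MulAction G S] [MulAction.IsPretransitive G S] {B : Set S} {N : ℕ}
    (hfin : ∀ g : G, (symmDiff (g • B) B).Finite)
    (hcard : ∀ g : G, (symmDiff (g • B) B).ncard ≤ N) : B.Finite ∨ Bᶜ.Finite := by
  classical
  by_contra! hB
  obtain ⟨hB, hBc⟩ := hB
  let b : S → ℝ := B.indicator 1
  have hb (s : S) : b s = if s ∈ B then 1 else 0 := by simp [b, Set.indicator_apply]
  have step : ∀ n : ℕ, ∃ w : S → ℝ, (∀ s, 0 ≤ w s ∧ w s ≤ 1) ∧
      (∀ g : G, {s | w (g • s) ≠ b s}.Finite) ∧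
      (∀ (g : G) (F : Finset S), ∑ s ∈ F, |w (g • s) - b s| ≤ N) ∧
      ∃ F : Finset S, (n : ℝ) / 4 ≤ ∑ s ∈ F, w s * (1 - w s) := by
    intro n
    induction n with
    | zero =>
      have hsub (g : G) : {s | b (g • s) ≠ b s} ⊆ symmDiff (g⁻¹ • B) B := by
        intro s hs
        rw [Set.mem_symmDiff, Set.mem_inv_smul_set_iff]
        by_cases h1 : g • s ∈ B <;> by_cases h2 : s ∈ B <;> simp_all
      refine ⟨b, fun s => ?_, fun g => (hfin g⁻¹).subset (hsub g), fun g F => ?_, ∅, by simp⟩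
      · rw [hb]; split_ifs <;> norm_num
      · calc ∑ s ∈ F, |b (g • s) - b s|
            ≤ ∑ s ∈ F, if s ∈ (hfin g⁻¹).toFinset then (1 : ℝ) else 0 := by
              refine Finset.sum_le_sum fun s _ => ?_
              by_cases h : b (g • s) = b s
              · rw [h, sub_self, abs_zero]; split_ifs <;> norm_num
              · rw [if_pos ((hfin g⁻¹).mem_toFinset.2 (hsub g h)), hb, hb]
                split_ifs <;> norm_num
          _ = ((F ∩ (hfin g⁻¹).toFinset).card : ℝ) := by
              rw [← Finset.sum_filter, Finset.sum_const, nsmul_one, Finset.filter_mem_eq_inter]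
          _ ≤ N := by
              refine Nat.cast_le.2 ((Finset.card_le_card Finset.inter_subset_right).trans ?_)
              rw [← Set.ncard_eq_toFinset_card _ (hfin g⁻¹)]
              exact hcard g⁻¹
    | succ n ih =>
      obtain ⟨w, h01, hsupp, hN, F, hF⟩ := ih
      have hsupp1 : {s | w s ≠ b s}.Finite := by simpa using hsupp 1
      obtain ⟨s, hsB, hs⟩ := hB.exists_notMem_finite hsupp1
      obtain ⟨t, htB, ht⟩ := hBc.exists_notMem_finite hsupp1
      have hws : w s = 1 := by rw [not_not.1 hs, hb, if_pos hsB]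
      have hwt : w t = 0 := by rw [not_not.1 ht, hb, if_neg htB]
      obtain ⟨g, hg⟩ := MulAction.exists_smul_eq G s t
      refine ⟨fun x => (w x + w (g • x)) / 2, fun x => ?_, fun h => ?_, fun h E => ?_,
        (F ∪ F.image (g⁻¹ • ·)) ∪ {s}, ?_⟩
      · have h1 := h01 x
        have h2 := h01 (g • x)
        constructor <;> linarith [h1.1, h1.2, h2.1, h2.2]
      · refine ((hsupp h).union (hsupp (g * h))).subset fun x hx => ?_
        by_contra! hx'
        simp only [Set.mem_union, Set.mem_ofPred_eq, not_or, not_not, mul_smul] at hx'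
        exact hx (by simp only [hx'.1, hx'.2]; ring)
      · have h1 := hN h E
        have h2 := hN (g * h) E
        calc ∑ x ∈ E, |(w (h • x) + w (g • h • x)) / 2 - b x|
            ≤ ∑ x ∈ E, (|w (h • x) - b x| + |w ((g * h) • x) - b x|) / 2 := by
              refine Finset.sum_le_sum fun x _ => ?_
              rw [mul_smul]
              have := abs_add_le (w (h • x) - b x) (w (g • h • x) - b x)
              rw [show (w (h • x) + w (g • h • x)) / 2 - b x =
                ((w (h • x) - b x) + (w (g • h • x) - b x)) / 2 by ring, abs_div, abs_two]
              linarith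
          _ ≤ N := by
              rw [← Finset.sum_div, Finset.sum_add_distrib]
              linarith
      · set E := (F ∪ F.image (g⁻¹ • ·)) ∪ {s}
        have hnn (x : S) : 0 ≤ w x * (1 - w x) :=
          mul_nonneg (h01 x).1 (sub_nonneg.2 (h01 x).2)
        have e1 : (n : ℝ) / 4 ≤ ∑ x ∈ E, w x * (1 - w x) :=
          hF.trans (Finset.sum_le_sum_of_subset_of_nonneg
            (fun x hx => by simp [E, hx]) fun x _ _ => hnn x)
        have e2 : (n : ℝ) / 4 ≤ ∑ x ∈ E, w (g • x) * (1 - w (g • x)) := by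
          refine hF.trans ?_
          calc ∑ x ∈ F, w x * (1 - w x)
              = ∑ x ∈ F.image (g⁻¹ • ·), w (g • x) * (1 - w (g • x)) := by
                rw [Finset.sum_image fun x _ y _ h => MulAction.injective g⁻¹ h]
                simp
            _ ≤ _ := Finset.sum_le_sum_of_subset_of_nonneg
                (fun x hx => Finset.mem_union_left _ (Finset.mem_union_right _ hx))
                fun x _ _ => hnn _
        have e3 : (1 : ℝ) ≤ ∑ x ∈ E, (w x - w (g • x)) ^ 2 := by
          have hsE : s ∈ E := by simp [E]
          refine le_trans ?_ (Finset.single_le_sum (fun x _ => sq_nonneg (w x - w (g • x))) hsE)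
          rw [hg, hws, hwt]; norm_num
        calc ((n + 1 : ℕ) : ℝ) / 4
            ≤ (∑ x ∈ E, w x * (1 - w x)) / 2 + (∑ x ∈ E, w (g • x) * (1 - w (g • x))) / 2 +
                (∑ x ∈ E, (w x - w (g • x)) ^ 2) / 4 := by push_cast; linarith
          _ = _ := by
              rw [Finset.sum_div, Finset.sum_div, Finset.sum_div, ← Finset.sum_add_distrib,
                ← Finset.sum_add_distrib]
              exact Finset.sum_congr rfl fun x _ => by ring
  obtain ⟨w, h01, -, hN, F, hF⟩ := step (4 * N + 1)
  have hle : ∑ s ∈ F, w s * (1 - w s) ≤ ∑ s ∈ F, |w ((1 : G) • s) - b s| := by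
    refine Finset.sum_le_sum fun s _ => ?_
    have h1 := h01 s
    rw [one_smul, hb]
    split_ifs
    · rw [abs_sub_comm, abs_of_nonneg (sub_nonneg.2 h1.2)]
      exact mul_le_of_le_one_left (sub_nonneg.2 h1.2) h1.2
    · rw [sub_zero, abs_of_nonneg h1.1]
      exact mul_le_of_le_one_right h1.1 (by linarith [h1.1])
  have := hF.trans (hle.trans (hN 1 F))
  push_cast at this
  linarith

/-! ### Half spaces of median algebras -/

namespace MedianAlgebra

section

variable {M : Type v} [MedianAlgebra M]

theorem med_mem_interval (x y z : M) : med x y z ∈ interval x y := by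
  change med x y z = med x y (med x y z)
  have h1 : med y x y = y := by rw [med_swap, med_self]
  rw [← med_rotate (med x y z) x y, ← med_rotate z x y, med_med, med_self, h1]

/-- A half space separating `x` from `y` is the preimage of its trace on the interval `[x, y]`
under the projection `z ↦ med x y z`. -/
theorem med_mem_iff_of_mem_separator {x y : M} {H : Set M} (hH : H ∈ separator x y) (z : M) :
    med x y z ∈ H ↔ z ∈ H := by
  obtain ⟨⟨h1, h2⟩, hx, hy⟩ := hH
  constructor
  · intro h
    by_contra hz
    refine h2 y hy z hz ?_ h
    rw [med_rotate]
    exact med_mem_interval y z x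
  · intro hz
    refine h1 x hx z hz ?_
    rw [med_swap]
    exact med_mem_interval x z y

theorem separator_finite_of_interval_finite {x y : M} (h : (interval x y).Finite) :
    (separator x y).Finite := by
  refine Set.Finite.of_finite_image (f := fun H => H ∩ interval x y)
    (h.powerset.subset ?_) fun H hH H' hH' hEq => ?_
  · rintro _ ⟨H, -, rfl⟩
    exact Set.inter_subset_right
  · ext z
    rw [← med_mem_iff_of_mem_separator hH, ← med_mem_iff_of_mem_separator hH']
    have := Set.ext_iff.1 hEq (med x y z)
    simpa [med_mem_interval x y z] using this

end

section Action

variable {G : Type u} [Group G] {M : Type v} [MedianAlgebra M] [MulAction G M]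

theorem IsMedianAction.isConvex_smul (hG : IsMedianAction G M) (g : G) {C : Set M}
    (hC : IsConvex C) : IsConvex (g • C) := by
  intro x hx y hy z hz
  rw [Set.mem_smul_set_iff_inv_smul_mem] at *
  refine hC _ hx _ hy ?_
  change g⁻¹ • z = _
  rw [← hG, ← show z = med x y z from hz]

theorem IsMedianAction.isHalfSpace_smul (hG : IsMedianAction G M) (g : G) {H : Set M}
    (hH : IsHalfSpace H) : IsHalfSpace (g • H) :=
  ⟨hG.isConvex_smul g hH.1, by rw [← Set.smul_set_compl]; exact hG.isConvex_smul g hH.2⟩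

theorem IsMedianAction.separator_smul (hG : IsMedianAction G M) (g : G) (x y : M) :
    separator (g • x) (g • y) = (g • ·) '' separator x y := by
  ext H
  constructor
  · rintro ⟨h, hx, hy⟩
    refine ⟨g⁻¹ • H, ⟨hG.isHalfSpace_smul _ h, ?_, ?_⟩, smul_inv_smul g H⟩
    · rwa [Set.mem_inv_smul_set_iff]
    · rwa [Set.mem_inv_smul_set_iff]
  · rintro ⟨H, ⟨h, hx, hy⟩, rfl⟩
    exact ⟨hG.isHalfSpace_smul _ h, Set.smul_mem_smul_set hx,
      fun hy' => hy (Set.smul_mem_smul_set_iff.1 hy')⟩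

theorem IsMedianAction.dist_smul (hG : IsMedianAction G M) (g : G) (x y : M) :
    dist (g • x) (g • y) = dist x y := by
  rw [dist, dist, hG.separator_smul, Set.ncard_image_of_injective _ (MulAction.injective g)]

/-! ### Ends of stabilizers of half spaces -/

/-- The half spaces in the orbit of `H` that contain `x` form a commensurated subset of this orbit,
which is isomorphic to `G ⧸ stabilizer G H`: `g` changes only the half spaces that separate `x` and
`g • x`. -/
theorem IsMedianAction.finite_or_finite_of_numEnds_le_one (hG : IsMedianAction G M)
    (hM : IsDiscrete M) {H : Set M} (hH : IsHalfSpace H)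
    (hends : EndsOfPairs.numEnds (MulAction.stabilizer G H) ≤ 1) (x : M) :
    {H' ∈ MulAction.orbit G H | x ∈ H'}.Finite ∨ {H' ∈ MulAction.orbit G H | x ∉ H'}.Finite := by
  by_contra! hinf
  refine hends.not_gt (EndsOfPairs.one_lt_numEnds_iff.2 ?_)
  let φ : G ⧸ MulAction.stabilizer G H → Set M := MulAction.ofQuotientStabilizer G H
  have hφ : Function.Injective φ := MulAction.injective_ofQuotientStabilizer G H
  have hsmul (g : G) (q) : φ (g • q) = g • φ q := MulAction.ofQuotientStabilizer_smul G H g q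
  have hhalf (q) : IsHalfSpace (φ q) := by
    induction q using QuotientGroup.induction_on with
    | H g => exact hG.isHalfSpace_smul g hH
  refine ⟨{q | x ∈ φ q}, fun hfin => hinf.1 ((hfin.image φ).subset ?_),
    fun hfin => hinf.2 ((hfin.image φ).subset ?_), fun g => ?_⟩
  · rintro _ ⟨⟨g, rfl⟩, hx⟩
    exact ⟨(g : G ⧸ MulAction.stabilizer G H), hx, rfl⟩
  · rintro _ ⟨⟨g, rfl⟩, hx⟩
    exact ⟨(g : G ⧸ MulAction.stabilizer G H), hx, rfl⟩
  · refine (((hM x (g • x)).union (hM (g • x) x)).preimage hφ.injOn).subset fun q hq => ?_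
    rw [Set.mem_symmDiff, Set.mem_smul_set_iff_inv_smul_mem, Set.mem_ofPred_eq, Set.mem_ofPred_eq,
      hsmul, Set.mem_inv_smul_set_iff] at hq
    exact hq.elim (fun h => Or.inr ⟨hhalf q, h⟩) fun h => Or.inl ⟨hhalf q, h⟩

/-- If `G` is finitely generated, the half spaces separating points of the orbit of `x` belong to
finitely many `G`-orbits: those of the half spaces separating `x` from its translates by
generators. -/
theorem IsMedianAction.exists_finite_separator_subset [Group.FG G] (hG : IsMedianAction G M)
    (hM : IsDiscrete M) (x : M) :
    ∃ E : Set (Set M), E.Finite ∧ (∀ H ∈ E, IsHalfSpace H) ∧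
      ∀ g : G, separator x (g • x) ⊆ ⋃ H ∈ E, MulAction.orbit G H := by
  obtain ⟨S, hS, hSfin⟩ := Group.fg_iff.1 (inferInstance : Group.FG G)
  set E : Set (Set M) := ⋃ s ∈ S, (separator x (s • x) ∪ separator (s • x) x) with hE
  have smul_mem (g : G) (H : Set M) (h : g • H ∈ ⋃ H ∈ E, MulAction.orbit G H) :
      H ∈ ⋃ H ∈ E, MulAction.orbit G H := by
    simp only [Set.mem_iUnion] at h ⊢
    obtain ⟨H', hH', h⟩ := h
    exact ⟨H', hH', inv_smul_smul g H ▸ MulAction.mapsTo_smul_orbit g⁻¹ H' h⟩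
  have key (g : G) : ∀ H : Set M, IsHalfSpace H → ¬(x ∈ H ↔ g • x ∈ H) →
      H ∈ ⋃ H ∈ E, MulAction.orbit G H := by
    have hg : g ∈ Subgroup.closure S := hS ▸ Subgroup.mem_top g
    induction hg using Subgroup.closure_induction with
    | mem s hs =>
      intro H hH hx
      refine Set.mem_biUnion ?_ (MulAction.mem_orbit_self H)
      refine Set.mem_biUnion hs ?_
      by_cases h : x ∈ H
      · exact Or.inl ⟨hH, h, fun h' => hx (iff_of_true h h')⟩
      · exact Or.inr ⟨hH, by_contra fun h' => hx (iff_of_false h h'), h⟩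
    | one => exact fun H _ hx => absurd (by rw [one_smul]) hx
    | mul a b _ _ ha hb =>
      intro H hH hx
      by_cases h : x ∈ H ↔ a • x ∈ H
      · refine smul_mem a⁻¹ H (hb _ (hG.isHalfSpace_smul _ hH) ?_)
        rwa [Set.mem_inv_smul_set_iff, Set.mem_inv_smul_set_iff, ← h, ← mul_smul]
      · exact ha H hH h
    | inv a _ ha =>
      intro H hH hx
      refine smul_mem a H (ha _ (hG.isHalfSpace_smul _ hH) ?_)
      rwa [Set.mem_smul_set_iff_inv_smul_mem, Set.smul_mem_smul_set_iff, iff_comm]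
  refine ⟨E, hSfin.biUnion fun s _ => (hM _ _).union (hM _ _), fun H hH => ?_,
    fun g H hH => key g H hH.1 fun h => hH.2.2 (h.1 hH.2.1)⟩
  simp only [hE, Set.mem_iUnion] at hH
  obtain ⟨s, -, h | h⟩ := hH
  · exact h.1
  · exact h.1

/-- Within the orbit of `H`, the number of half spaces separating `x` from `g • x` is at most the
size of the finite one of the two sets in `finite_or_finite_of_numEnds_le_one`, as the sets for `x`
and `g • x` are translates of each other. -/
theorem exists_ncard_separator_inter_orbit_le {H : Set M} {x : M}
    (h : {H' ∈ MulAction.orbit G H | x ∈ H'}.Finite ∨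
      {H' ∈ MulAction.orbit G H | x ∉ H'}.Finite) :
    ∃ n : ℕ, ∀ g : G, (separator x (g • x) ∩ MulAction.orbit G H).ncard ≤ n := by
  obtain h | h := h
  · exact ⟨Set.ncard {H' ∈ MulAction.orbit G H | x ∈ H'},
      fun g => Set.ncard_le_ncard (fun H' hH' => ⟨hH'.2, hH'.1.2.1⟩) h⟩
  · refine ⟨Set.ncard {H' ∈ MulAction.orbit G H | x ∉ H'}, fun g =>
      (Set.ncard_le_ncard (fun H' hH' => ?_) (h.image (g • ·))).trans_eq
      (Set.ncard_image_of_injective _ (MulAction.injective g))⟩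
    refine ⟨g⁻¹ • H', ⟨MulAction.mapsTo_smul_orbit g⁻¹ H hH'.2, ?_⟩, smul_inv_smul g H'⟩
    rw [Set.mem_inv_smul_set_iff]
    exact hH'.1.2.2

theorem IsMedianAction.exists_one_lt_numEnds [Group.FG G] [Nonempty M] (hG : IsMedianAction G M)
    (hM : IsDiscrete M) (hell : ¬ IsElliptic G M) :
    ∃ K : Subgroup G, 1 < EndsOfPairs.numEnds K := by
  by_contra! hends
  obtain ⟨x⟩ := ‹Nonempty M›
  obtain ⟨E, hEfin, hEhalf, hE⟩ := hG.exists_finite_separator_subset hM x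
  have hbd (H : E) : ∃ n : ℕ, ∀ g : G, (separator x (g • x) ∩ MulAction.orbit G H.1).ncard ≤ n :=
    exists_ncard_separator_inter_orbit_le
      (hG.finite_or_finite_of_numEnds_le_one hM (hEhalf H.1 H.2) (hends _) x)
  choose n hn using hbd
  have := hEfin.fintype
  have hdist (g : G) : dist x (g • x) ≤ ∑ H : E, n H := by
    refine le_trans ?_ (Finset.sum_le_sum fun H _ => hn H g)
    have hcover : separator x (g • x) ⊆
        ⋃ H ∈ (Finset.univ : Finset E), separator x (g • x) ∩ MulAction.orbit G H.1 := by
      intro H' hH'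
      obtain ⟨H, hH, h⟩ := Set.mem_iUnion₂.1 (hE g hH')
      exact Set.mem_biUnion (Finset.mem_coe.2 (Finset.mem_univ ⟨H, hH⟩)) ⟨hH', h⟩
    refine (Set.ncard_le_ncard hcover ((hM x (g • x)).subset ?_)).trans
      (Finset.set_ncard_biUnion_le _ _)
    exact Set.iUnion₂_subset fun H _ => Set.inter_subset_left
  refine hell ⟨x, ∑ H : E, n H, ?_⟩
  rintro _ ⟨a, rfl⟩ _ ⟨b, rfl⟩
  have := hdist (a⁻¹ * b)
  rwa [← hG.dist_smul a, ← mul_smul, mul_inv_cancel_left] at this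

end Action

end MedianAlgebra

/-! ### The median algebra of sets almost equal to a given set -/

/-- The sets almost equal to `B`, that is, those whose symmetric difference with `B` is finite. -/
def AlmostEqualSets {S : Type v} (B : Set S) : Type v := {X : Set S // (symmDiff X B).Finite}

namespace AlmostEqualSets

open MedianAlgebra

variable {S : Type v} {B : Set S}

/-- The median of three sets consists of the points that lie in at least two of them. -/
instance : MedianAlgebra (AlmostEqualSets B) where
  med X Y Z := ⟨X.1 ∩ Y.1 ∪ X.1 ∩ Z.1 ∪ Y.1 ∩ Z.1,
    ((X.2.union Y.2).union Z.2).subset fun s hs => by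
      simp only [Set.mem_symmDiff, Set.mem_union, Set.mem_inter_iff] at hs ⊢
      tauto⟩
  med_swap X Y Z := Subtype.ext <| by
    ext s; simp only [Set.mem_union, Set.mem_inter_iff]; tauto
  med_rotate X Y Z := Subtype.ext <| by
    ext s; simp only [Set.mem_union, Set.mem_inter_iff]; tauto
  med_self X Y := Subtype.ext <| by
    ext s; simp only [Set.mem_union, Set.mem_inter_iff]; tauto
  med_med X Y Z U W := Subtype.ext <| by
    ext s; simp only [Set.mem_union, Set.mem_inter_iff]; tauto

theorem mem_med (X Y Z : AlmostEqualSets B) (s : S) :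
    s ∈ (med X Y Z).1 ↔ (s ∈ X.1 ∧ s ∈ Y.1 ∨ s ∈ X.1 ∧ s ∈ Z.1) ∨ s ∈ Y.1 ∧ s ∈ Z.1 := Iff.rfl

theorem finite_symmDiff (X Y : AlmostEqualSets B) : (symmDiff X.1 Y.1).Finite :=
  (X.2.union Y.2).subset fun s hs => by
    simp only [Set.mem_symmDiff, Set.mem_union] at hs ⊢
    tauto

theorem interval_finite (X Y : AlmostEqualSets B) : (interval X Y).Finite := by
  refine Set.Finite.of_finite_image (f := fun Z => symmDiff Z.1 X.1)
    ((finite_symmDiff X Y).powerset.subset ?_) fun Z _ Z' _ h => Subtype.ext ?_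
  · rintro _ ⟨Z, hZ, rfl⟩ s hs
    have h : s ∈ Z.1 ↔ s ∈ (med X Y Z).1 := by rw [← show Z = med X Y Z from hZ]
    rw [mem_med] at h
    simp only [Set.mem_symmDiff] at hs ⊢
    tauto
  · exact symmDiff_left_injective X.1 h

theorem isDiscrete (B : Set S) : IsDiscrete (AlmostEqualSets B) := fun X Y =>
  separator_finite_of_interval_finite (interval_finite X Y)

theorem isHalfSpace_setOf_mem (s : S) : IsHalfSpace {X : AlmostEqualSets B | s ∈ X.1} := by
  constructor
  · intro X hX Y hY Z hZ
    rw [show Z = med X Y Z from hZ]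
    exact Or.inl (Or.inl ⟨hX, hY⟩)
  · intro X hX Y hY Z hZ
    rw [show Z = med X Y Z from hZ]
    simp only [Set.mem_compl_iff, Set.mem_ofPred_eq, mem_med] at hX hY ⊢
    tauto

theorem setOf_mem_injective :
    Function.Injective fun s : S => {X : AlmostEqualSets B | s ∈ X.1} := by
  intro s t hst
  by_contra hne
  have hfin : (symmDiff ((B ∪ {s}) \ {t}) B).Finite :=
    (Set.toFinite {s, t}).subset fun r hr => by
      simp only [Set.mem_symmDiff, Set.mem_sdiff, Set.mem_union, Set.mem_singleton_iff,
        Set.mem_insert_iff] at hr ⊢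
      tauto
  have h := Set.ext_iff.1 hst ⟨_, hfin⟩
  exact (h.1 ⟨Or.inr rfl, hne⟩).2 rfl

theorem ncard_diff_le_dist (X Y : AlmostEqualSets B) : (X.1 \ Y.1).ncard ≤ dist X Y :=
  Set.ncard_le_ncard_of_injOn _ (fun s hs => ⟨isHalfSpace_setOf_mem s, hs.1, hs.2⟩)
    setOf_mem_injective.injOn (isDiscrete B X Y)

variable {G : Type u} [Group G] [MulAction G S]

/-- The translation action on the sets almost equal to a commensurated set `B`. -/
abbrev mulAction (hB : ∀ g : G, (symmDiff (g • B) B).Finite) :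
    MulAction G (AlmostEqualSets B) where
  smul g X := ⟨g • X.1, ((X.2.image (g • ·)).union (hB g)).subset fun s hs => by
    change _ ∈ g • symmDiff X.1 B ∪ _
    rw [Set.smul_set_symmDiff]
    simp only [Set.mem_symmDiff, Set.mem_union] at hs ⊢
    tauto⟩
  one_smul X := Subtype.ext (one_smul G X.1)
  mul_smul g h X := Subtype.ext (mul_smul g h X.1)

theorem isMedianAction (hB : ∀ g : G, (symmDiff (g • B) B).Finite) :
    letI := mulAction hB
    IsMedianAction G (AlmostEqualSets B) := by
  intro g X Y Z
  refine Subtype.ext ?_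
  change g • (X.1 ∩ Y.1 ∪ X.1 ∩ Z.1 ∪ Y.1 ∩ Z.1) =
    g • X.1 ∩ g • Y.1 ∪ g • X.1 ∩ g • Z.1 ∪ g • Y.1 ∩ g • Z.1
  simp only [Set.smul_set_union, Set.smul_set_inter]

/-- The distance between sets is at least half the size of their symmetric difference, so that
`Set.finite_or_finite_compl_of_ncard_symmDiff_le` applies to a set with bounded orbit. -/
theorem not_isElliptic [MulAction.IsPretransitive G S]
    (hB : ∀ g : G, (symmDiff (g • B) B).Finite) (hinf : B.Infinite) (hinf' : Bᶜ.Infinite) :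
    letI := mulAction hB
    ¬ IsElliptic G (AlmostEqualSets B) := by
  let := mulAction hB
  rintro ⟨X, N, hN⟩
  have hX : X ∈ MulAction.orbit G X := MulAction.mem_orbit_self X
  have h := Set.finite_or_finite_compl_of_ncard_symmDiff_le (G := G) (B := X.1) (N := N + N)
    (fun g => finite_symmDiff (g • X) X) fun g => by
      have hgX : g • X ∈ MulAction.orbit G X := MulAction.mem_orbit X g
      exact (Set.ncard_union_le _ _).trans (add_le_add
        ((ncard_diff_le_dist (g • X) X).trans (hN _ hgX _ hX))
        ((ncard_diff_le_dist X (g • X)).trans (hN _ hX _ hgX)))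
  obtain h | h := h
  · refine hinf ((h.union X.2).subset fun s hs => ?_)
    simp only [Set.mem_symmDiff, Set.mem_union]
    tauto
  · refine hinf' ((h.union X.2).subset fun s hs => ?_)
    simp only [Set.mem_symmDiff, Set.mem_union, Set.mem_compl_iff] at hs ⊢
    tauto

end AlmostEqualSets

/-! ### The equivalence -/

theorem Group.FG.countable (G : Type u) [Group G] [Group.FG G] : Countable G := by
  obtain ⟨α, _, φ, hφ⟩ := Group.fg_iff_exists_freeGroup_hom_surjective_finite.1
    (inferInstance : Group.FG G)
  have : Countable (FreeGroup α) := inferInstanceAs (Countable (Quot _))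
  exact hφ.countable

theorem theorem11p6 (G : Type u) [Group G] [Group.FG G] :
    (∃ K : Subgroup G, 1 < EndsOfPairs.numEnds K) ↔
      ∃ (M : Type v) (_ : MedianAlgebra M) (_ : MulAction G M),
        Nonempty M ∧ MedianAlgebra.IsDiscrete M ∧ MedianAlgebra.IsMedianAction G M ∧
          ¬ MedianAlgebra.IsElliptic G M := by
  constructor
  · rintro ⟨K, hK⟩
    obtain ⟨B, hB, hBc, hcomm⟩ := EndsOfPairs.one_lt_numEnds_iff.1 hK
    -- `G ⧸ K` is countable, so that it has a copy in the universe required for `M`.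
    have := Group.FG.countable G
    have : Countable (G ⧸ K) := Quotient.countable
    let e : G ⧸ K ≃ Shrink.{v, u} (G ⧸ K) := equivShrink.{v, u} (G ⧸ K)
    have he (g : G) (q : G ⧸ K) : e (g • q) = g • e q := equivShrink_smul.{v} g q
    have : MulAction.IsPretransitive G (Shrink.{v, u} (G ⧸ K)) := ⟨fun s t => by
      obtain ⟨g, hg⟩ := MulAction.exists_smul_eq G (e.symm s) (e.symm t)
      exact ⟨g, by rw [← e.apply_symm_apply s, ← he, hg, e.apply_symm_apply]⟩⟩
    have hcomm' (g : G) : (symmDiff (g • e '' B) (e '' B)).Finite := by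
      have : g • e '' B = e '' (g • B) := (Set.image_smul_comm e g B (he g)).symm
      rw [this, ← Set.image_symmDiff e.injective]
      exact (hcomm g).image e
    refine ⟨AlmostEqualSets (e '' B), inferInstance, AlmostEqualSets.mulAction hcomm',
      ⟨⟨e '' B, by simp⟩⟩, AlmostEqualSets.isDiscrete _, AlmostEqualSets.isMedianAction hcomm',
      AlmostEqualSets.not_isElliptic hcomm' (hB.image e.injective.injOn) ?_⟩
    rw [← Set.image_compl_eq e.bijective]
    exact hBc.image e.injective.injOn
  · rintro ⟨M, _, _, _, hM, hG, hell⟩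
    exact hG.exists_one_lt_numEnds hM hell
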